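/- Consider a fully connected network with $L$ layers of widths $n_0=d,n_1,\ldots,n_{L-1},n_L=m$ (all positive), activation $\sigma:\mathbb{R}\to\mathbb{R}$, and training data $X=[x_1,\ldots,x_N]^T\in\mathbb{R}^{N\times d}$. For parameters $\theta=(W_l,b_l)_{l=1}^L\in\Omega=\prod_{l=1}^L\big(\mathbb{R}^{n_{l-1}\times n_l}\times\mathbb{R}^{n_l}\big)$ put $F_0=X$, $F_l=\sigma(F_{l-1}W_l+\mathbf{1}_Nb_l^T)$ (entrywise) for $1\le l\le L-1$, and $F_L(\theta)=F_{L-1}W_L+\mathbf{1}_Nb_L^T$. Let $\varphi:\mathbb{R}^{N\times m}\to\mathbb{R}$ be any convex function, $\Phi(\theta)=\varphi(F_L(\theta))$ the training loss, and $p^*=\inf_{G\in\mathbb{R}^{N\times m}}\varphi(G)\in[-\infty,\infty)$. A local valley of $\Phi$ is a nonempty (path-)connected component of a strict sublevel set $\{\theta\in\Omega:\Phi(\theta)<\alpha\}$, $\alpha\in\mathbb{R}$; it is a bad local valley if $\Phi$ cannot be made arbitrarily close to $p^*$ on it, i.e. if there is a real $c>p^*$ such that $\Phi\ge c$ on it.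 Assume that - $\sigma$ is strictly monotonic (increasing or decreasing) and $\sigma(\mathbb{R})=\mathbb{R}$; - there are no non-zero coefficients $\lambda_1,\ldots,\lambda_p$ and pairwise distinct non-zero shifts $a_1,\ldots,a_p$ such that $\sigma(x)=\sum_{i=1}^p\lambda_i\sigma(x-a_i)$ for every $x\in\mathbb{R}$; - the training samples $x_1,\ldots,x_N$ are distinct; - there is a layer $k\in\{1,\ldots,L-1\}$ such that $n_k\ge N$ and $n_{k+1}>n_{k+2}>\cdots>n_L$. Then: 1. The loss $\Phi$ has no bad local valleys. 2. If $k\le L-2$, then every local valley of $\Phi$ is unbounded. -/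

import Mathlib

namespace NeuralLoss

/-- The parameters `(W, b)` of one layer with `a` inputs and `c` outputs: a weight matrix
`W ∈ ℝ^{a × c}` (given by its entries) and a bias vector `b ∈ ℝ^c`. As a product of finite
powers of `ℝ` it carries the usual topology and the usual notion of boundedness of a
finite-dimensional real vector space. -/
abbrev LayerParams (a c : ℕ) : Type :=
  (Fin a → Fin c → ℝ) × (Fin c → ℝ)

/-- The parameter space `Ω = Ω₁ × ⋯ × Ω_L` of a fully connected network with `L` layers and
widths `n 0, …, n L`. The parameters of layer `l + 1`, which maps `n l` neurons to `n (l + 1)`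
neurons, are stored at the index `l : Fin L`. -/
abbrev Params (L : ℕ) (n : ℕ → ℕ) : Type :=
  ∀ l : Fin L, LayerParams (n l) (n (l + 1))

/-- The affine map of a layer applied to all samples (rows of `F`): `F W + 1_N bᵀ`. -/
def affine {N a c : ℕ} (p : LayerParams a c) (F : Matrix (Fin N) (Fin a) ℝ) :
    Matrix (Fin N) (Fin c) ℝ :=
  F * Matrix.of p.1 + Matrix.of fun _ j => p.2 j

/-- The output `F_k(θ) ∈ ℝ^{N × n_k}` of layer `k`, for `0 ≤ k ≤ L`: `F_0 = X`, and
`F_k = σ (F_{k-1} W_k + 1_N b_kᵀ)` entrywise for `1 ≤ k ≤ L - 1`, while the last layer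
`F_L = F_{L-1} W_L + 1_N b_Lᵀ` has no activation. -/
def layerOutput {L N : ℕ} {n : ℕ → ℕ} (σ : ℝ → ℝ) (X : Matrix (Fin N) (Fin (n 0)) ℝ)
    (θ : Params L n) : (k : ℕ) → k ≤ L → Matrix (Fin N) (Fin (n k)) ℝ
  | 0, _ => X
  | k + 1, h =>
    let Z := affine (θ ⟨k, h⟩) (layerOutput σ X θ k (Nat.le_of_succ_le h))
    if k + 1 = L then Z else Z.map σ

/-- The training loss `Φ(θ) = φ (F_L(θ))`. -/
def trainLoss {L N : ℕ} {n : ℕ → ℕ} (σ : ℝ → ℝ) (X : Matrix (Fin N) (Fin (n 0)) ℝ)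
    (φ : Matrix (Fin N) (Fin (n L)) ℝ → ℝ) (θ : Params L n) : ℝ :=
  φ (layerOutput σ X θ L le_rfl)

/-- `p* = inf_G φ(G)`, taken in the extended reals since it may be `-∞`. -/
noncomputable def optValue {M : Type*} (φ : M → ℝ) : EReal :=
  ⨅ G : M, (φ G : EReal)

/-- `σ` is strictly monotonic (increasing or decreasing) and `σ(ℝ) = ℝ`. -/
def StrictlyMonotonicOnto (σ : ℝ → ℝ) : Prop :=
  (StrictMono σ ∨ StrictAnti σ) ∧ Set.range σ = Set.univ

/-- There are no non-zero coefficients `λ_i` and pairwise distinct non-zero shifts `a_i` with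
`σ(x) = ∑ i, λ_i σ(x - a_i)` for every `x`. (The empty sum only excludes `σ = 0`, for which
there is also a relation with one term.) -/
def NoShiftDependence (σ : ℝ → ℝ) : Prop :=
  ¬ ∃ (p : ℕ) (lam a : Fin p → ℝ), (∀ i, lam i ≠ 0) ∧ (∀ i, a i ≠ 0) ∧
    Function.Injective a ∧ ∀ x : ℝ, σ x = ∑ i, lam i * σ (x - a i)

/-- The strict sublevel set `{θ | Φ(θ) < α}`. -/
def strictSublevel {Ω : Type*} (Φ : Ω → ℝ) (α : ℝ) : Set Ω :=
  {θ | Φ θ < α}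

/-- A local valley: a nonempty connected component of some strict sublevel set, where
connectedness is meant in the sense of continuous paths. -/
def IsLocalValley {Ω : Type*} [TopologicalSpace Ω] (Φ : Ω → ℝ) (C : Set Ω) : Prop :=
  ∃ α : ℝ, ∃ θ ∈ strictSublevel Φ α, C = pathComponentIn (strictSublevel Φ α) θ

/-- `Φ` can be made arbitrarily close to the lower bound `p` on `C` (arbitrarily small if
`p = -∞`). -/
def ArbitrarilyClose {Ω : Type*} (Φ : Ω → ℝ) (p : EReal) (C : Set Ω) : Prop :=
  ∀ c : ℝ, p < (c : EReal) → ∃ θ ∈ C, Φ θ < c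

/-- A bad local valley: a local valley on which `Φ` cannot be made arbitrarily close to `p`. -/
def IsBadLocalValley {Ω : Type*} [TopologicalSpace Ω] (Φ : Ω → ℝ) (p : EReal)
    (C : Set Ω) : Prop :=
  IsLocalValley Φ C ∧ ¬ ArbitrarilyClose Φ p C

end NeuralLoss

open NeuralLoss Matrix Set Topology

/-! ### Linear algebra -/

/-! From any point of a local valley a path inside the valley leads to a point where every output
matrix can be reached by changing one layer. Since the sublevel set is open, a small move keeps the
samples distinct up to layer `k - 1`. If `F_k` then lacks full row rank, its columns are dependent
because `n k ≥ N`; a redundant neuron is disconnected and replaced by one whose output leaves the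
column space, which exists by `NoShiftDependence` (`exists_range_lt`). Next the weights behind layer
`k + 1` get full column rank (`exists_full_column_rank`); both changes keep the network output
constant.

Now `σ` and the later weights can be inverted along paths, so any path of outputs lifts to the
parameters from layer `k` to `k + 1` (`exists_lift`). Lifting the segment to some `G` with `φ G < c`
stays in the valley by convexity.

For unboundedness, a weight matrix `W` with more rows than columns admits `V ≠ 0` and `P` with `P W
= W`, `P V = 0`; all `W + sV` are reached at constant output (`exists_shift_weight`). -/

lemma exists_left_inverse_of_mulVec_injective {a c : ℕ} (A : Matrix (Fin a) (Fin c) ℝ)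
    (hA : Function.Injective A.mulVec) : ∃ Q : Matrix (Fin c) (Fin a) ℝ, Q * A = 1 := by
  obtain ⟨g, hg⟩ := LinearMap.exists_leftInverse_of_injective A.mulVecLin
    (LinearMap.ker_eq_bot.2 hA)
  refine ⟨LinearMap.toMatrix' g, ?_⟩
  have h := congrArg LinearMap.toMatrix' hg
  rwa [LinearMap.toMatrix'_comp, ← Matrix.toLin'_apply' A,
    LinearMap.toMatrix'_toLin', LinearMap.toMatrix'_id] at h

lemma exists_right_inverse_of_range_eq_top {a c : ℕ} (A : Matrix (Fin a) (Fin c) ℝ)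
    (hA : LinearMap.range A.mulVecLin = ⊤) : ∃ R : Matrix (Fin c) (Fin a) ℝ, A * R = 1 := by
  obtain ⟨g, hg⟩ := LinearMap.exists_rightInverse_of_surjective A.mulVecLin hA
  refine ⟨LinearMap.toMatrix' g, ?_⟩
  have h := congrArg LinearMap.toMatrix' hg
  rwa [LinearMap.toMatrix'_comp, ← Matrix.toLin'_apply' A,
    LinearMap.toMatrix'_toLin', LinearMap.toMatrix'_id] at h

/-- A projection onto the column space of `W`. -/
lemma exists_projection_onto_range {a c : ℕ} (W : Matrix (Fin a) (Fin c) ℝ) :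
    ∃ P : Matrix (Fin a) (Fin a) ℝ, P * W = W ∧
      (∀ x, P *ᵥ x ∈ LinearMap.range W.mulVecLin) ∧ P * P = P := by
  obtain ⟨g, hg⟩ := LinearMap.exists_leftInverse_of_injective
    (LinearMap.range W.mulVecLin).subtype (Submodule.ker_subtype _)
  have hmem : ∀ x, LinearMap.toMatrix' ((LinearMap.range W.mulVecLin).subtype ∘ₗ g) *ᵥ x
      = g x := fun x => by rw [LinearMap.toMatrix'_mulVec]; rfl
  have hfix : ∀ y (hy : y ∈ LinearMap.range W.mulVecLin), (g y : Fin a → ℝ) = y := fun y hy =>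
    congrArg Subtype.val (LinearMap.congr_fun hg ⟨y, hy⟩)
  refine ⟨LinearMap.toMatrix' ((LinearMap.range W.mulVecLin).subtype ∘ₗ g), ?_, ?_, ?_⟩
  · refine Matrix.ext_of_mulVec_single fun i => ?_
    rw [← mulVec_mulVec, hmem]
    exact hfix _ ⟨_, rfl⟩
  · intro x
    rw [hmem]
    exact (g x).2
  · refine Matrix.ext_of_mulVec_single fun i => ?_
    rw [← mulVec_mulVec, hmem, hmem]
    exact hfix _ (g _).2

/-- With `F P` in place of `F`, adding `V` to `W` does not change the product. Full column rank
results from `V` embedding `ker W` into `ker P`, a complement of the range of `W`. -/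
lemma exists_projection_and_complement {a c : ℕ} (hca : c ≤ a) (W : Matrix (Fin a) (Fin c) ℝ) :
    ∃ (P : Matrix (Fin a) (Fin a) ℝ) (V : Matrix (Fin a) (Fin c) ℝ), P * W = W ∧ P * V = 0 ∧
      ∃ Q : Matrix (Fin c) (Fin a) ℝ, Q * (W + V) = 1 := by
  obtain ⟨P, hPW, hPr, hPP⟩ := exists_projection_onto_range W
  have hrange : LinearMap.range P.mulVecLin = LinearMap.range W.mulVecLin := by
    apply le_antisymm
    · rintro _ ⟨x, rfl⟩
      exact hPr x
    · rintro _ ⟨x, rfl⟩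
      exact ⟨W *ᵥ x, by simp [mulVec_mulVec, hPW]⟩
  have h1 := LinearMap.finrank_range_add_finrank_ker W.mulVecLin
  have h2 := LinearMap.finrank_range_add_finrank_ker P.mulVecLin
  rw [hrange] at h2
  simp only [Module.finrank_fin_fun] at h1 h2
  -- With `r` the common rank of `W` and `P`, the kernels have dimensions `c - r ≤ a - r`.
  obtain ⟨j, hj⟩ := (finrank_le_iff_exists_linearMap (R := ℝ) (M := LinearMap.ker W.mulVecLin)
    (M' := LinearMap.ker P.mulVecLin)).1 (by omega)
  obtain ⟨p, hp⟩ := LinearMap.exists_leftInverse_of_injective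
    (LinearMap.ker W.mulVecLin).subtype (Submodule.ker_subtype _)
  let V := LinearMap.toMatrix' ((LinearMap.ker P.mulVecLin).subtype ∘ₗ j ∘ₗ p)
  have hV : ∀ x, V *ᵥ x = j (p x) := fun x => by
    simp only [V, LinearMap.toMatrix'_mulVec]; rfl
  have hPV : ∀ x, P *ᵥ (V *ᵥ x) = 0 := fun x => by
    rw [hV]; exact (j (p x)).2
  refine ⟨P, V, hPW, Matrix.ext_of_mulVec_single fun i => by
    rw [← mulVec_mulVec, hPV, zero_mulVec], exists_left_inverse_of_mulVec_injective _ ?_⟩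
  refine (injective_iff_map_eq_zero (W + V).mulVecLin).2 fun x hx => ?_
  have hx : W *ᵥ x + V *ᵥ x = 0 := by rw [← add_mulVec]; exact hx
  have hWx : W *ᵥ x = 0 := by
    have := congrArg (P *ᵥ ·) hx
    simpa [mulVec_add, hPV, mulVec_mulVec, hPW] using this
  rw [hWx, zero_add, hV] at hx
  have hpx : p x = 0 := by
    apply hj
    rw [map_zero]
    exact Subtype.ext hx
  have := congrArg Subtype.val (LinearMap.congr_fun hp ⟨x, hWx⟩)
  simp only [LinearMap.comp_apply, Submodule.subtype_apply, hpx] at this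
  exact this.symm

lemma exists_projection_and_nonzero {a c : ℕ} (hc : 0 < c) (hca : c < a)
    (W : Matrix (Fin a) (Fin c) ℝ) :
    ∃ (P : Matrix (Fin a) (Fin a) ℝ) (V : Matrix (Fin a) (Fin c) ℝ), P * W = W ∧ P * V = 0 ∧
      V ≠ 0 := by
  obtain ⟨P, hPW, hPr, hPP⟩ := exists_projection_onto_range W
  have hne : LinearMap.range W.mulVecLin ≠ ⊤ := fun h => by
    have h1 := LinearMap.finrank_range_le W.mulVecLin
    rw [h] at h1
    simp at h1
    omega
  obtain ⟨y, hy⟩ : ∃ y, y ∉ LinearMap.range W.mulVecLin := by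
    by_contra! h
    exact hne (Submodule.eq_top_iff'.2 h)
  refine ⟨P, vecMulVec (y - P *ᵥ y) (fun _ => 1), hPW, ?_, ?_⟩
  · rw [mul_vecMulVec, mulVec_sub, mulVec_mulVec, hPP, sub_self, zero_vecMulVec]
  · intro h
    apply hy
    have : y = P *ᵥ y := by
      ext i
      have := congrFun (congrFun h i) ⟨0, hc⟩
      simpa [vecMulVec, sub_eq_zero] using this
    rw [this]
    exact hPr y

/-- Finitely many distinct vectors are separated by a linear functional. -/
lemma exists_dotProduct_injective {ι : Type*} [Finite ι] {a : ℕ} (f : ι → Fin a → ℝ)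
    (hf : Function.Injective f) : ∃ v : Fin a → ℝ, Function.Injective fun i => f i ⬝ᵥ v := by
  obtain ⟨g, hg⟩ := Module.exists_dual_forall_apply_ne_zero (K := ℝ)
    (fun q : {q : ι × ι // q.1 ≠ q.2} => f q.1.1 - f q.1.2)
    (fun q => sub_ne_zero.2 fun h => q.2 (hf h))
  have hrep : ∀ x, g x = x ⬝ᵥ fun j => g (Pi.single j 1) := fun x => by
    rw [LinearMap.pi_apply_eq_sum_univ g x]
    refine Finset.sum_congr rfl fun i _ => ?_
    rw [smul_eq_mul]
    congr 2
    ext j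
    simp [Pi.single_apply, eq_comm]
  refine ⟨fun j => g (Pi.single j 1), fun i i' h => ?_⟩
  by_contra hne
  apply hg ⟨(i, i'), hne⟩
  change g (f i - f i') = 0
  rw [map_sub, hrep (f i), hrep (f i')]
  exact sub_eq_zero.2 h

/-! ### Shifts of the activation -/

/-- A non-zero coefficient at `i₀` would let `σ (s i₀ + b)` be solved for; with `x = s i₀ + b` this
is a forbidden relation with shifts `s i₀ - s i`. Terms with zero coefficient must be dropped first.
-/
lemma NeuralLoss.NoShiftDependence.eq_zero {σ : ℝ → ℝ} (hσ : NoShiftDependence σ)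
    {ι : Type*} [Fintype ι] (s lam : ι → ℝ) (hs : Function.Injective s)
    (h : ∀ b, ∑ i, lam i * σ (s i + b) = 0) : lam = 0 := by
  classical
  by_contra hne
  obtain ⟨i₀, hi₀⟩ := Function.ne_iff.1 hne
  simp only [Pi.zero_apply] at hi₀
  let e := (Fintype.equivFin {i : ι // i ≠ i₀ ∧ lam i ≠ 0}).symm
  refine hσ ⟨_, fun q => -(lam (e q) / lam i₀), fun q => s i₀ - s (e q), fun q => ?_, fun q => ?_,
    fun q q' hq => ?_, fun x => ?_⟩
  · exact neg_ne_zero.2 (div_ne_zero (e q).2.2 hi₀)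
  · exact sub_ne_zero.2 fun h => (e q).2.1 (hs h).symm
  · exact e.injective (Subtype.ext (hs (sub_right_injective hq)))
  · rw [e.sum_comp (fun i => -(lam i / lam i₀) * σ (x - (s i₀ - s i)))]
    have h1 := h (x - s i₀)
    rw [Fintype.sum_eq_add_sum_compl i₀] at h1
    rw [add_sub_cancel] at h1
    have h2 : ∑ i : {i : ι // i ≠ i₀ ∧ lam i ≠ 0}, -(lam i / lam i₀) * σ (x - (s i₀ - s i))
        = -(lam i₀)⁻¹ * ∑ i ∈ {i₀}ᶜ, lam i * σ (s i + (x - s i₀)) := by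
      rw [Finset.mul_sum, ← Finset.sum_subtype (s := Finset.univ.filter
        fun i => i ≠ i₀ ∧ lam i ≠ 0) (p := fun i => i ≠ i₀ ∧ lam i ≠ 0) (h := by simp)
        (f := fun i => -(lam i / lam i₀) * σ (x - (s i₀ - s i)))]
      refine Finset.sum_subset_zero_on_sdiff (fun i => by simp +contextual) (fun i hi => ?_)
        fun i _ => ?_
      · simp only [Finset.mem_sdiff, Finset.mem_compl, Finset.mem_singleton, Finset.mem_filter,
          Finset.mem_univ, true_and, not_and, not_not] at hi
        simp [hi.2 hi.1]
      · rw [show x - (s i₀ - s i) = s i + (x - s i₀) by ring]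
        ring
    rw [h2, eq_neg_of_add_eq_zero_right h1]
    field_simp

/-- Otherwise a non-zero functional `f` vanishing on `S` kills all neurons with a fixed weight `v`
separating the rows. Varying the bias gives a relation between shifts of `σ` with coefficients `f
(Pi.single i 1)`, so `f = 0`. -/
lemma exists_neuron_notMem {σ : ℝ → ℝ} (hσ : NoShiftDependence σ) {N a : ℕ}
    (F : Matrix (Fin N) (Fin a) ℝ) (hF : Function.Injective fun i => F i)
    (S : Submodule ℝ (Fin N → ℝ)) (hS : S ≠ ⊤) :
    ∃ (w : Fin a → ℝ) (b : ℝ), (fun i => σ ((F *ᵥ w) i + b)) ∉ S := by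
  obtain ⟨v, hv⟩ := exists_dotProduct_injective _ hF
  obtain ⟨f, hf, hSf⟩ := Submodule.exists_le_ker_of_lt_top S hS.lt_top
  by_contra! h
  apply hf
  have hz := hσ.eq_zero (fun i => F i ⬝ᵥ v) (fun i => f (Pi.single i 1)) hv fun b => by
    have := LinearMap.mem_ker.1 (hSf (h v b))
    rw [LinearMap.pi_apply_eq_sum_univ] at this
    rw [← this]
    refine Finset.sum_congr rfl fun i _ => ?_
    rw [smul_eq_mul, mul_comm]
    congr 2
    ext j
    simp [Pi.single_apply, eq_comm]
  ext i
  simpa using congrFun hz i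

/-! ### Layers -/

namespace NeuralLoss

/-- The nonlinearity behind layer `j`: the activation, or the identity for the last layer. -/
def activate (L j : ℕ) (σ : ℝ → ℝ) {N c : ℕ} (Z : Matrix (Fin N) (Fin c) ℝ) :
    Matrix (Fin N) (Fin c) ℝ :=
  if j = L then Z else Z.map σ

variable {L N : ℕ} {n : ℕ → ℕ} {σ : ℝ → ℝ} {X : Matrix (Fin N) (Fin (n 0)) ℝ}

lemma layerOutput_succ (θ : Params L n) (j : ℕ) (h : j + 1 ≤ L) :
    layerOutput σ X θ (j + 1) h =
      activate L (j + 1) σ (affine (θ ⟨j, h⟩) (layerOutput σ X θ j (Nat.le_of_succ_le h))) :=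
  rfl

lemma layerOutput_congr_of_lt {θ θ' : Params L n} (j : ℕ) (h : j ≤ L)
    (hθ : ∀ i (hi : i < L), i < j → θ' ⟨i, hi⟩ = θ ⟨i, hi⟩) :
    layerOutput σ X θ' j h = layerOutput σ X θ j h := by
  induction j with
  | zero => rfl
  | succ j ih =>
    rw [layerOutput_succ, layerOutput_succ, hθ j h j.lt_succ_self,
      ih _ fun i hi hij => hθ i hi (hij.trans j.lt_succ_self)]

lemma layerOutput_congr_of_le {θ θ' : Params L n} (j : ℕ) (h : j ≤ L)
    (hj : layerOutput σ X θ' j h = layerOutput σ X θ j h)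
    (hθ : ∀ i (hi : i < L), j ≤ i → θ' ⟨i, hi⟩ = θ ⟨i, hi⟩) (l : ℕ) (hjl : j ≤ l) (hl : l ≤ L) :
    layerOutput σ X θ' l hl = layerOutput σ X θ l hl := by
  induction l, hjl using Nat.le_induction with
  | base => exact hj
  | succ l hjl ih => rw [layerOutput_succ, layerOutput_succ, hθ l hl hjl, ih (by omega)]

lemma layerOutput_update_of_le (θ : Params L n) {l : ℕ} (hl : l < L)
    (p : LayerParams (n l) (n (l + 1))) (j : ℕ) (hj : j ≤ L) (hjl : j ≤ l) :
    layerOutput σ X (Function.update θ ⟨l, hl⟩ p) j hj = layerOutput σ X θ j hj :=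
  layerOutput_congr_of_lt j hj fun i hi hij =>
    Function.update_of_ne (by simp only [ne_eq, Fin.mk.injEq]; omega) _ _

lemma layerOutput_update_succ (θ : Params L n) {l : ℕ} (hl : l < L)
    (p : LayerParams (n l) (n (l + 1))) :
    layerOutput σ X (Function.update θ ⟨l, hl⟩ p) (l + 1) hl =
      activate L (l + 1) σ (affine p (layerOutput σ X θ l hl.le)) := by
  rw [layerOutput_succ, layerOutput_update_of_le θ hl p l _ le_rfl, Function.update_self]

/-- Changing a layer without changing its response leaves the later outputs unchanged. -/
lemma layerOutput_update_eq (θ : Params L n) {l : ℕ} (hl : l < L)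
    (p : LayerParams (n l) (n (l + 1)))
    (hp : affine p (layerOutput σ X θ l hl.le) = affine (θ ⟨l, hl⟩) (layerOutput σ X θ l hl.le))
    (j : ℕ) (hj : j ≤ L) (hlj : l + 1 ≤ j) :
    layerOutput σ X (Function.update θ ⟨l, hl⟩ p) j hj = layerOutput σ X θ j hj := by
  refine layerOutput_congr_of_le (l + 1) hl ?_ (fun i hi hij => ?_) j hlj hj
  · rw [layerOutput_update_succ, hp, layerOutput_succ]
  · exact Function.update_of_ne (by simp only [ne_eq, Fin.mk.injEq]; omega) _ _

lemma affine_mk {a c : ℕ} (W : Matrix (Fin a) (Fin c) ℝ) (b : Fin c → ℝ)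
    (F : Matrix (Fin N) (Fin a) ℝ) :
    affine (W, b) F = F * W + Matrix.of fun _ j => b j := rfl

/-- The weight matrix of the layer with index `l`. -/
def weight (θ : Params L n) (l : ℕ) (hl : l < L) : Matrix (Fin (n l)) (Fin (n (l + 1))) ℝ :=
  Matrix.of (θ ⟨l, hl⟩).1

lemma affine_layer (θ : Params L n) (l : ℕ) (hl : l < L) (F : Matrix (Fin N) (Fin (n l)) ℝ) :
    affine (θ ⟨l, hl⟩) F = F * weight θ l hl + Matrix.of fun _ j => (θ ⟨l, hl⟩).2 j := rfl

/-! ### Continuity -/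

lemma continuous_layerOutput (hσ : Continuous σ) (j : ℕ) (h : j ≤ L) :
    Continuous fun θ : Params L n => layerOutput σ X θ j h := by
  induction j with
  | zero => exact continuous_const
  | succ j ih =>
    have hZ : Continuous fun θ : Params L n =>
        affine (θ ⟨j, h⟩) (layerOutput σ X θ j (Nat.le_of_succ_le h)) := by
      have h1 : Continuous fun θ : Params L n => (θ ⟨j, h⟩) := continuous_apply _
      exact ((ih (Nat.le_of_succ_le h)).matrix_mul h1.fst).add
        (continuous_matrix fun _ c => (continuous_apply c).comp h1.snd)
    simp only [layerOutput_succ, activate]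
    split_ifs
    · exact hZ
    · exact hZ.matrix_map hσ

lemma continuous_of_convexOn {a c : ℕ} (φ : Matrix (Fin a) (Fin c) ℝ → ℝ)
    (hφ : ConvexOn ℝ univ φ) : Continuous φ :=
  continuousOn_univ.1 (ConvexOn.continuousOn (E := Fin a → Fin c → ℝ) isOpen_univ hφ)

lemma continuous_trainLoss (hσ : Continuous σ) (φ : Matrix (Fin N) (Fin (n L)) ℝ → ℝ)
    (hφ : ConvexOn ℝ univ φ) : Continuous (trainLoss σ X φ) :=
  (continuous_of_convexOn φ hφ).comp (continuous_layerOutput hσ L le_rfl)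

/-- Continuity of `σ` and of its inverse is automatic for a monotone bijection of `ℝ`. -/
lemma StrictlyMonotonicOnto.exists_homeomorph (hσ : StrictlyMonotonicOnto σ) :
    ∃ e : ℝ ≃ₜ ℝ, ⇑e = σ := by
  obtain ⟨hm | hm, hr⟩ := hσ
  · exact ⟨(hm.orderIsoOfSurjective σ (range_eq_univ.1 hr)).toHomeomorph, rfl⟩
  · have hneg : StrictMono fun x => -σ x := fun x y h => neg_lt_neg (hm h)
    have hs : Function.Surjective fun x => -σ x := neg_surjective.comp (range_eq_univ.1 hr)
    refine ⟨(hneg.orderIsoOfSurjective _ hs).toHomeomorph.trans (Homeomorph.neg ℝ), ?_⟩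
    ext x
    exact neg_neg (σ x)

/-! ### Paths changing one layer -/

lemma joinedIn_update {U : Set (Params L n)} (θ : Params L n) (l : Fin L)
    (p : ℝ → LayerParams (n l) (n (l + 1))) (hp : Continuous p) (h0 : p 0 = θ l)
    (hU : ∀ t ∈ Icc (0 : ℝ) 1, Function.update θ l (p t) ∈ U) :
    JoinedIn U θ (Function.update θ l (p 1)) := by
  refine JoinedIn.ofLine (f := fun t => Function.update θ l (p t))
    (continuous_const.update l hp).continuousOn ?_ rfl ?_
  · simp [h0]
  · rintro _ ⟨t, ht, rfl⟩
    exact hU t ht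

/-- The exact start `Z₀` matters: lifted paths must begin at the current parameters. -/
lemma exists_preactivation_path (e : ℝ ≃ₜ ℝ) (j : ℕ) {c : ℕ}
    (G : ℝ → Matrix (Fin N) (Fin c) ℝ) (hG : Continuous G) (Z₀ : Matrix (Fin N) (Fin c) ℝ)
    (h0 : G 0 = activate L j e Z₀) :
    ∃ Z : ℝ → Matrix (Fin N) (Fin c) ℝ, Continuous Z ∧ Z 0 = Z₀ ∧
      ∀ t, activate L j e (Z t) = G t := by
  by_cases hj : j = L
  · refine ⟨G, hG, ?_, fun t => by simp [activate, hj]⟩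
    simpa [activate, hj] using h0
  · refine ⟨fun t => (G t).map e.symm, hG.matrix_map e.symm.continuous, ?_, fun t => ?_⟩
    · simp only [h0]
      ext
      simp [activate, hj]
    · ext
      simp [activate, hj]

/-- Paths of the output of layer `l > k` are realized by changing the layer with index `k` only,
provided that `F_k` has full row rank and the weights in between have full column rank. -/
lemma exists_lift (e : ℝ ≃ₜ ℝ) (θ : Params L n) (k : ℕ) (hk : k < L)
    (R : Matrix (Fin (n k)) (Fin N) ℝ) (hR : layerOutput e X θ k hk.le * R = 1)
    (l : ℕ) (hkl : k + 1 ≤ l) (hl : l ≤ L)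
    (hQ : ∀ j (hj : j < L), k + 1 ≤ j → j < l →
      ∃ Q : Matrix (Fin (n (j + 1))) (Fin (n j)) ℝ, Q * weight θ j hj = 1)
    (G : ℝ → Matrix (Fin N) (Fin (n l)) ℝ) (hG : Continuous G)
    (h0 : G 0 = layerOutput e X θ l hl) :
    ∃ p : ℝ → LayerParams (n k) (n (k + 1)), Continuous p ∧ p 0 = θ ⟨k, hk⟩ ∧
      ∀ t, layerOutput e X (Function.update θ ⟨k, hk⟩ (p t)) l hl = G t := by
  induction l, hkl using Nat.le_induction with
  | base =>
    obtain ⟨Z, hZc, hZ0, hZ⟩ := exists_preactivation_path e (k + 1) G hG _ h0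
    -- As `F_k R = 1`, this correction adds exactly `Z t - Z 0` to the preactivation.
    refine ⟨fun t => (weight θ k hk + R * (Z t - Z 0), (θ ⟨k, hk⟩).2), ?_, ?_, fun t => ?_⟩
    · refine Continuous.prodMk ?_ continuous_const
      exact continuous_const.add (continuous_const.matrix_mul (hZc.sub continuous_const))
    · simp only [sub_self, Matrix.mul_zero, add_zero]
      rfl
    · rw [layerOutput_update_succ, ← hZ t, affine_mk, Matrix.mul_add, ← Matrix.mul_assoc, hR,
        Matrix.one_mul, add_right_comm, ← affine_layer, hZ0, add_sub_cancel]
  | succ l hkl ih =>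
    obtain ⟨Z, hZc, hZ0, hZ⟩ := exists_preactivation_path e (l + 1) G hG _ h0
    obtain ⟨Q, hQl⟩ := hQ l hl hkl l.lt_succ_self
    obtain ⟨p, hp, hp0, hpt⟩ := ih (Nat.le_of_succ_le hl)
      (fun j hj hkj hjl => hQ j hj hkj (hjl.trans l.lt_succ_self))
      -- Right multiplication by the weight matrix cancels `Q` and leaves `Z t - Z 0`.
      (fun t => layerOutput e X θ l (Nat.le_of_succ_le hl) + (Z t - Z 0) * Q)
      (continuous_const.add ((hZc.sub continuous_const).matrix_mul continuous_const))
      (by simp)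
    refine ⟨p, hp, hp0, fun t => ?_⟩
    have hne : (⟨l, hl⟩ : Fin L) ≠ ⟨k, hk⟩ := by simp only [ne_eq, Fin.mk.injEq]; omega
    rw [layerOutput_succ, hpt, Function.update_of_ne hne, ← hZ t, affine_layer, Matrix.add_mul,
      Matrix.mul_assoc, hQl, Matrix.mul_one, add_right_comm, ← affine_layer, hZ0, add_sub_cancel]

/-- With `F_k` of full row rank, the weight matrix `W` of a layer `l > k` can be changed by any
`V` killed on the left by some `P` with `P W = W`, at constant network output. -/
lemma exists_shift_weight (e : ℝ ≃ₜ ℝ) (θ : Params L n) (k : ℕ) (hk : k < L)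
    (R : Matrix (Fin (n k)) (Fin N) ℝ) (hR : layerOutput e X θ k hk.le * R = 1)
    (l : ℕ) (hkl : k + 1 ≤ l) (hl : l < L)
    (hQ : ∀ j (hj : j < L), k + 1 ≤ j → j < l →
      ∃ Q : Matrix (Fin (n (j + 1))) (Fin (n j)) ℝ, Q * weight θ j hj = 1)
    (P : Matrix (Fin (n l)) (Fin (n l)) ℝ) (V : Matrix (Fin (n l)) (Fin (n (l + 1))) ℝ)
    (hPW : P * weight θ l hl = weight θ l hl) (hPV : P * V = 0) :
    ∃ θ' : Params L n,
      JoinedIn {η | layerOutput e X η L le_rfl = layerOutput e X θ L le_rfl} θ θ' ∧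
      weight θ' l hl = weight θ l hl + V ∧ (∀ j, j ≠ ⟨k, hk⟩ → j ≠ ⟨l, hl⟩ → θ' j = θ j) ∧
      layerOutput e X θ' k hk.le = layerOutput e X θ k hk.le := by
  set F := layerOutput e X θ l hl.le with hF
  -- Moving `F` to `F P` is invisible behind the layer because `P W = W`; afterwards `V` can be
  -- added because `F P V = 0`.
  obtain ⟨p, hp, hp0, hpt⟩ := exists_lift e θ k hk R hR l hkl hl.le hQ
    (fun t => F + t • (F * P - F)) (by fun_prop) (by simp [F])
  have hne : (⟨l, hl⟩ : Fin L) ≠ ⟨k, hk⟩ := by simp only [ne_eq, Fin.mk.injEq]; omega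
  have hout : ∀ t, layerOutput e X (Function.update θ ⟨k, hk⟩ (p t)) L le_rfl =
      layerOutput e X θ L le_rfl := fun t => by
    refine layerOutput_congr_of_le (l + 1) hl ?_ (fun i hi hij => ?_) L hl le_rfl
    · rw [layerOutput_succ, layerOutput_succ, hpt, Function.update_of_ne hne, affine_layer,
        affine_layer, Matrix.add_mul, Matrix.smul_mul, Matrix.sub_mul, Matrix.mul_assoc, hPW,
        sub_self, smul_zero, add_zero]
    · exact Function.update_of_ne (by simp only [ne_eq, Fin.mk.injEq]; omega) _ _
  have h1 := joinedIn_update (U := {η | layerOutput e X η L le_rfl = layerOutput e X θ L le_rfl})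
    θ ⟨k, hk⟩ p hp hp0 fun t _ => hout t
  set θ₁ := Function.update θ ⟨k, hk⟩ (p 1) with hθ₁
  have hF₁ : layerOutput e X θ₁ l hl.le = F * P := by rw [hpt]; simp
  have hl₁ : θ₁ ⟨l, hl⟩ = θ ⟨l, hl⟩ := Function.update_of_ne hne _ _
  have h2 := joinedIn_update (U := {η | layerOutput e X η L le_rfl = layerOutput e X θ L le_rfl})
    θ₁ ⟨l, hl⟩ (fun t => (weight θ l hl + t • V, (θ ⟨l, hl⟩).2))
    (Continuous.prodMk (continuous_const.add (continuous_id.smul continuous_const))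
      continuous_const) (by simp only [zero_smul, add_zero]; exact hl₁.symm)
    (fun t _ => by
      change layerOutput e X _ L le_rfl = _
      rw [layerOutput_update_eq θ₁ hl _ ?_ L le_rfl hl]
      · exact hout 1
      · rw [hF₁, hl₁, affine_mk, affine_layer, Matrix.mul_add, Matrix.mul_smul,
          Matrix.mul_assoc F P V, hPV, Matrix.mul_zero, smul_zero, add_zero])
  refine ⟨_, h1.trans h2, ?_, fun j hjk hjl => ?_, ?_⟩
  · simp only [weight, Function.update_self, one_smul]
    rfl
  · rw [Function.update_of_ne hjl, hθ₁, Function.update_of_ne hjk]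
  · rw [layerOutput_update_of_le θ₁ hl _ k _ (by omega), hθ₁,
      layerOutput_update_of_le θ hk _ k _ le_rfl]

/-- All weight matrices behind layer `k + 1` can be given full column rank at constant output. -/
lemma exists_full_column_rank (e : ℝ ≃ₜ ℝ) (θ : Params L n) (k : ℕ) (hk : k < L)
    (R : Matrix (Fin (n k)) (Fin N) ℝ) (hR : layerOutput e X θ k hk.le * R = 1)
    (hdec : ∀ l, k + 1 ≤ l → l + 1 ≤ L → n (l + 1) ≤ n l)
    (l : ℕ) (hkl : k + 1 ≤ l) (hl : l ≤ L) :
    ∃ θ' : Params L n,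
      JoinedIn {η | layerOutput e X η L le_rfl = layerOutput e X θ L le_rfl} θ θ' ∧
      layerOutput e X θ' k hk.le = layerOutput e X θ k hk.le ∧
      ∀ j (hj : j < L), k + 1 ≤ j → j < l →
        ∃ Q : Matrix (Fin (n (j + 1))) (Fin (n j)) ℝ, Q * weight θ' j hj = 1 := by
  induction l, hkl using Nat.le_induction with
  | base => exact ⟨θ, JoinedIn.refl rfl, rfl, fun j hj h1 h2 => by omega⟩
  | succ l hkl ih =>
    obtain ⟨θ₁, hθ₁, hk₁, hQ₁⟩ := ih (Nat.le_of_succ_le hl)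
    obtain ⟨P, V, hPW, hPV, Q, hQ⟩ :=
      exists_projection_and_complement (hdec l hkl hl) (weight θ₁ l hl)
    obtain ⟨θ₂, hθ₂, hW, hj, hk₂⟩ := exists_shift_weight e θ₁ k hk R (by rw [hk₁, hR]) l hkl hl
      hQ₁ P V hPW hPV
    have hout : layerOutput e X θ₁ L le_rfl = layerOutput e X θ L le_rfl := hθ₁.target_mem
    rw [hout] at hθ₂
    refine ⟨θ₂, hθ₁.trans hθ₂, hk₂.trans hk₁, fun j hjL hkj hjl => ?_⟩
    rcases (Nat.lt_succ_iff.1 hjl).eq_or_lt with rfl | hlt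
    · exact ⟨Q, by rw [hW, hQ]⟩
    -- The shift touched only the indices `k` and `l`, so earlier left inverses survive.
    · obtain ⟨Q', hQ'⟩ := hQ₁ j hjL hkj hlt
      refine ⟨Q', ?_⟩
      rw [weight, hj _ (by simp only [ne_eq, Fin.mk.injEq]; omega)
        (by simp only [ne_eq, Fin.mk.injEq]; omega)]
      exact hQ'

/-! ### Distinct rows and full row rank -/

/-- Within an open set, the samples can be kept distinct through all the hidden layers. -/
lemma exists_joinedIn_injective_rows (e : ℝ ≃ₜ ℝ) (hX : Function.Injective fun i => X i)
    (hn : ∀ l ≤ L, 0 < n l) {U : Set (Params L n)} (hU : IsOpen U) (θ : Params L n) (hθ : θ ∈ U)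
    (l : ℕ) (hl : l < L) :
    ∃ θ' : Params L n, JoinedIn U θ θ' ∧
      Function.Injective fun i => layerOutput e X θ' l hl.le i := by
  induction l with
  | zero => exact ⟨θ, JoinedIn.refl hθ, hX⟩
  | succ l ih =>
    have hl' : l < L := Nat.lt_of_succ_lt hl
    obtain ⟨θ₁, hθ₁, hinj⟩ := ih hl'
    obtain ⟨v, hv⟩ := exists_dotProduct_injective _ hinj
    set F := layerOutput e X θ₁ l hl'.le with hF
    let V : Matrix (Fin (n l)) (Fin (n (l + 1))) ℝ := Matrix.of fun j _ => v j
    let p : ℝ → LayerParams (n l) (n (l + 1)) :=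
      fun t => (weight θ₁ l hl' + t • V, (θ₁ ⟨l, hl'⟩).2)
    have hp : Continuous p :=
      Continuous.prodMk (continuous_const.add (continuous_id.smul continuous_const))
        continuous_const
    have hp0 : p 0 = θ₁ ⟨l, hl'⟩ := by
      simp only [p, zero_smul, add_zero]
      rfl
    let γ : ℝ → Params L n := fun t => Function.update θ₁ ⟨l, hl'⟩ (p t)
    have hγ : Continuous γ := continuous_const.update _ hp
    have hγ0 : γ 0 ∈ U := by
      simp only [γ, hp0, Function.update_eq_self]
      exact hθ₁.target_mem
    obtain ⟨δ, hδ, hball⟩ := Metric.isOpen_iff.1 (hU.preimage hγ) 0 hγ0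
    -- One neuron suffices to separate the samples. For each pair its preactivations differ by an
    -- affine function of `t` with non-zero slope, so only finitely many `t` are bad.
    let c : Fin (n (l + 1)) := ⟨0, hn _ hl.le⟩
    let bad : Set ℝ := ⋃ q : {q : Fin N × Fin N // q.1 ≠ q.2},
      {t | (F * (weight θ₁ l hl' + t • V)) q.1.1 c = (F * (weight θ₁ l hl' + t • V)) q.1.2 c}
    have hentry : ∀ t i, (F * (weight θ₁ l hl' + t • V)) i c =
        (F * weight θ₁ l hl') i c + t * (F i ⬝ᵥ v) := fun t i => by
      rw [Matrix.mul_add, Matrix.mul_smul, Matrix.add_apply, Matrix.smul_apply, smul_eq_mul]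
      rfl
    have hbad : bad.Finite := by
      refine finite_iUnion fun q => Set.Subsingleton.finite fun t ht t' ht' => ?_
      have ht : (F * (weight θ₁ l hl' + t • V)) q.1.1 c =
        (F * (weight θ₁ l hl' + t • V)) q.1.2 c := ht
      have ht' : (F * (weight θ₁ l hl' + t' • V)) q.1.1 c =
        (F * (weight θ₁ l hl' + t' • V)) q.1.2 c := ht'
      rw [hentry, hentry] at ht ht'
      have hne : F q.1.1 ⬝ᵥ v - F q.1.2 ⬝ᵥ v ≠ 0 := sub_ne_zero.2 fun h => q.2 (hv h)
      apply mul_right_cancel₀ hne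
      linear_combination ht - ht'
    obtain ⟨t, ⟨ht0, htδ⟩, htb⟩ := (Ioo_infinite hδ).exists_notMem_finite hbad
    refine ⟨γ t, hθ₁.trans ?_, fun i i' h => ?_⟩
    · have := joinedIn_update (U := U) θ₁ ⟨l, hl'⟩ (fun s => p (s * t))
        (hp.comp (continuous_id.mul continuous_const)) (by simpa using hp0) fun s hs => by
          refine hball ?_
          rw [mem_ball_zero_iff, Real.norm_of_nonneg (mul_nonneg hs.1 ht0.le)]
          exact (mul_le_of_le_one_left ht0.le hs.2).trans_lt htδ
      simpa using this
    · by_contra hne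
      refine htb (mem_iUnion.2 ⟨⟨(i, i'), hne⟩, ?_⟩)
      have h := congrFun h c
      simp only [γ, layerOutput_update_succ, activate, hl.ne, if_false, Matrix.map_apply,
        e.injective.eq_iff, p, affine_mk, Matrix.add_apply, Matrix.of_apply, add_left_inj] at h
      exact h

/-- If `F_{m+1}` does not have full row rank, its column space can be enlarged at constant output:
a neuron with redundant output is disconnected and then replaced. -/
lemma exists_range_lt (e : ℝ ≃ₜ ℝ) (he : NoShiftDependence e) (θ : Params L n) (m : ℕ)
    (hm : m + 1 < L) (hN : N ≤ n (m + 1))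
    (hinj : Function.Injective fun i => layerOutput e X θ m (by omega) i)
    (htop : LinearMap.range (layerOutput e X θ (m + 1) hm.le).mulVecLin ≠ ⊤) :
    ∃ θ' : Params L n,
      JoinedIn {η | layerOutput e X η L le_rfl = layerOutput e X θ L le_rfl} θ θ' ∧
      layerOutput e X θ' m (by omega) = layerOutput e X θ m (by omega) ∧
      LinearMap.range (layerOutput e X θ (m + 1) hm.le).mulVecLin <
        LinearMap.range (layerOutput e X θ' (m + 1) hm.le).mulVecLin := by
  have hm' : m < L := by omega
  set E := layerOutput e X θ m hm'.le with hE
  set F := layerOutput e X θ (m + 1) hm.le with hF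
  set W := weight θ (m + 1) hm with hW
  -- a linear dependence of the columns of `F`
  obtain ⟨g, hg, j, hj⟩ : ∃ g, F *ᵥ g = 0 ∧ ∃ j, g j ≠ 0 := by
    have h1 := LinearMap.finrank_range_add_finrank_ker F.mulVecLin
    have h2 := Submodule.finrank_lt htop
    simp only [Module.finrank_fin_fun] at h1 h2
    obtain ⟨g, hg, hg0⟩ := Submodule.exists_mem_ne_zero_of_ne_bot
      (p := LinearMap.ker F.mulVecLin) (fun h => by
        rw [h, finrank_bot] at h1
        omega)
    exact ⟨g, hg, Function.ne_iff.1 hg0⟩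
  -- `F A = F` since `F g = 0`, while row `j` of `A` vanishes: the weights `A W` ignore neuron `j`
  -- at the same response.
  let A : Matrix (Fin (n (m + 1))) (Fin (n (m + 1))) ℝ :=
    1 - vecMulVec ((g j)⁻¹ • g) (Pi.single j 1)
  have hFA : F * A = F := by
    simp only [A, Matrix.mul_sub, Matrix.mul_one, mul_vecMulVec, mulVec_smul, hg, smul_zero,
      zero_vecMulVec, sub_zero]
  have hAj : ∀ i, A j i = 0 := fun i => by
    simp [A, vecMulVec_apply, Matrix.one_apply, Pi.single_apply, hj, eq_comm]
  -- disconnect neuron `j`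
  have h1 := joinedIn_update (U := {η | layerOutput e X η L le_rfl = layerOutput e X θ L le_rfl})
    θ ⟨m + 1, hm⟩ (fun t => (W + t • (A * W - W), (θ ⟨m + 1, hm⟩).2))
    (Continuous.prodMk (continuous_const.add (continuous_id.smul continuous_const))
      continuous_const) (by simp only [zero_smul, add_zero]; rfl)
    (fun t _ => by
      refine layerOutput_update_eq θ hm _ ?_ L le_rfl hm
      rw [affine_mk, affine_layer, Matrix.mul_add, Matrix.mul_smul, Matrix.mul_sub,
        ← Matrix.mul_assoc, ← hF, hFA, sub_self, smul_zero, add_zero])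
  set θ₁ := Function.update θ ⟨m + 1, hm⟩
    ((W + (1 : ℝ) • (A * W - W), (θ ⟨m + 1, hm⟩).2) :
      LayerParams (n (m + 1)) (n (m + 1 + 1))) with hθ₁
  have hout₁ : layerOutput e X θ₁ L le_rfl = layerOutput e X θ L le_rfl := h1.target_mem
  have hE₁ : layerOutput e X θ₁ m hm'.le = E := layerOutput_update_of_le θ hm _ m _ (by omega)
  have hF₁ : layerOutput e X θ₁ (m + 1) hm.le = F := layerOutput_update_of_le θ hm _ _ _ le_rfl
  have hW₁ : weight θ₁ (m + 1) hm = A * W := by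
    simp only [weight, hθ₁, Function.update_self, one_smul, add_sub_cancel]
    rfl
  have hWj : ∀ i, (A * W) j i = 0 := fun i => by
    simp [Matrix.mul_apply, hAj]
  -- replace neuron `j`
  obtain ⟨w, b, hwb⟩ := exists_neuron_notMem he E hinj _ htop
  set q : LayerParams (n m) (n (m + 1)) := θ ⟨m, hm'⟩ with hq
  have hθ₁m : θ₁ ⟨m, hm'⟩ = q :=
    Function.update_of_ne (by simp only [ne_eq, Fin.mk.injEq]; omega) _ _
  let p : ℝ → LayerParams (n m) (n (m + 1)) := fun t =>
    (fun i => Function.update (q.1 i) j (q.1 i j + t * (w i - q.1 i j)),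
      Function.update q.2 j (q.2 j + t * (b - q.2 j)))
  have hp : Continuous p := by
    refine Continuous.prodMk (continuous_pi fun i => ?_) ?_
    · exact continuous_const.update j (by fun_prop)
    · exact continuous_const.update j (by fun_prop)
  have hp0 : p 0 = θ₁ ⟨m, hm'⟩ := by
    rw [hθ₁m]
    simp [p]
  have hFcol : ∀ t i c, c ≠ j →
      layerOutput e X (Function.update θ₁ ⟨m, hm'⟩ (p t)) (m + 1) hm.le i c = F i c := by
    intro t i c hc
    rw [layerOutput_update_succ, hE₁, hF, layerOutput_succ]
    simp only [activate, hm.ne, if_false, Matrix.map_apply]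
    congr 1
    simp [affine, Matrix.mul_apply, p, Function.update_of_ne hc, hq, hE]
  have hmul : ∀ t z, z j = 0 →
      layerOutput e X (Function.update θ₁ ⟨m, hm'⟩ (p t)) (m + 1) hm.le *ᵥ z = F *ᵥ z := by
    intro t z hz
    ext i
    simp only [mulVec, dotProduct]
    refine Finset.sum_congr rfl fun c _ => ?_
    by_cases hc : c = j
    · simp [hc, hz]
    · rw [hFcol t i c hc]
  have h2 := joinedIn_update (U := {η | layerOutput e X η L le_rfl = layerOutput e X θ L le_rfl})
    θ₁ ⟨m, hm'⟩ p hp hp0 (fun t _ => by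
      change layerOutput e X _ L le_rfl = _
      rw [← hout₁]
      refine layerOutput_congr_of_le (m + 1 + 1) hm ?_ (fun i hi hij =>
        Function.update_of_ne (by simp only [ne_eq, Fin.mk.injEq]; omega) _ _) L hm le_rfl
      rw [layerOutput_succ _ (m + 1), layerOutput_succ θ₁ (m + 1),
        Function.update_of_ne (by simp only [ne_eq, Fin.mk.injEq]; omega), affine_layer,
        affine_layer, hW₁, hF₁]
      congr 2
      refine Matrix.ext_of_mulVec_single fun i => ?_
      rw [← mulVec_mulVec, ← mulVec_mulVec _ F]
      refine hmul t ((A * W) *ᵥ Pi.single i 1) ?_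
      rw [mulVec_single_one]
      exact hWj i)
  refine ⟨_, h1.trans h2, ?_, ?_⟩
  · rw [layerOutput_update_of_le θ₁ hm' _ m _ le_rfl, hE₁]
  · refine lt_of_le_of_ne ?_ fun h => hwb ?_
    -- No old column combination is lost: `F y = F (A y)`, and `A y` does not use the replaced
    -- column `j`.
    · rintro _ ⟨y, rfl⟩
      refine ⟨A *ᵥ y, ?_⟩
      rw [mulVecLin_apply, mulVecLin_apply, hmul 1 _ ?_, mulVec_mulVec, hFA]
      simp [mulVec, dotProduct, hAj]
    · rw [h]
      refine ⟨Pi.single j 1, ?_⟩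
      rw [mulVecLin_apply, mulVec_single_one]
      ext i
      rw [Matrix.col_apply, layerOutput_update_succ, hE₁]
      simp only [activate, hm.ne, if_false, Matrix.map_apply]
      congr 1
      simp [affine, Matrix.mul_apply, p, mulVec, dotProduct]

/-- The output of a wide layer can be given full row rank at constant network output. -/
lemma exists_full_row_rank (e : ℝ ≃ₜ ℝ) (he : NoShiftDependence e) (θ : Params L n) (m : ℕ)
    (hm : m + 1 < L) (hN : N ≤ n (m + 1))
    (hinj : Function.Injective fun i => layerOutput e X θ m (by omega) i) :
    ∃ θ' : Params L n,
      JoinedIn {η | layerOutput e X η L le_rfl = layerOutput e X θ L le_rfl} θ θ' ∧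
      ∃ R : Matrix (Fin (n (m + 1))) (Fin N) ℝ, layerOutput e X θ' (m + 1) hm.le * R = 1 := by
  -- Strictly increasing column spaces in `ℝ^N` must reach the whole space.
  induction hS : LinearMap.range (layerOutput e X θ (m + 1) hm.le).mulVecLin using
    WellFoundedGT.induction generalizing θ with
  | ind S ih =>
    by_cases htop : S = ⊤
    · exact ⟨θ, JoinedIn.refl rfl, exists_right_inverse_of_range_eq_top _ (hS.trans htop)⟩
    · rw [← hS] at htop
      obtain ⟨θ₁, hθ₁, hm₁, hlt⟩ := exists_range_lt e he θ m hm hN hinj htop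
      obtain ⟨θ₂, hθ₂, hR⟩ := ih _ (hS ▸ hlt) θ₁ (by rwa [hm₁]) rfl
      have hout : layerOutput e X θ₁ L le_rfl = layerOutput e X θ L le_rfl := hθ₁.target_mem
      rw [hout] at hθ₂
      exact ⟨θ₂, hθ₁.trans hθ₂, hR⟩

/-! ### Local valleys -/

lemma isOpen_strictSublevel {Ω : Type*} [TopologicalSpace Ω] {Φ : Ω → ℝ} (hΦ : Continuous Φ)
    (α : ℝ) : IsOpen (strictSublevel Φ α) :=
  isOpen_lt hΦ continuous_const

lemma setOf_layerOutput_eq_subset (φ : Matrix (Fin N) (Fin (n L)) ℝ → ℝ) {α : ℝ}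
    {θ : Params L n} (hθ : θ ∈ strictSublevel (trainLoss σ X φ) α) :
    {η | layerOutput σ X η L le_rfl = layerOutput σ X θ L le_rfl} ⊆
      strictSublevel (trainLoss σ X φ) α := fun η hη => by
  have hη : layerOutput σ X η L le_rfl = layerOutput σ X θ L le_rfl := hη
  change φ _ < α
  rw [hη]
  exact hθ

/-- Every local valley contains a point at which the wide layer has full row rank. -/
lemma exists_joinedIn_full_row_rank (e : ℝ ≃ₜ ℝ) (he : NoShiftDependence e)
    (hX : Function.Injective fun i => X i) (hn : ∀ l ≤ L, 0 < n l)
    (φ : Matrix (Fin N) (Fin (n L)) ℝ → ℝ) (hφ : ConvexOn ℝ univ φ) (k : ℕ) (hk₁ : 1 ≤ k)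
    (hk : k < L) (hkN : N ≤ n k) {α : ℝ} {θ : Params L n}
    (hθ : θ ∈ strictSublevel (trainLoss e X φ) α) :
    ∃ θ' : Params L n, JoinedIn (strictSublevel (trainLoss e X φ) α) θ θ' ∧
      ∃ R : Matrix (Fin (n k)) (Fin N) ℝ, layerOutput e X θ' k hk.le * R = 1 := by
  obtain ⟨m, rfl⟩ : ∃ m, k = m + 1 := ⟨k - 1, by omega⟩
  -- This move may change the loss; openness of the sublevel set keeps it inside.
  obtain ⟨θ₁, hθ₁, hinj⟩ := exists_joinedIn_injective_rows e hX hn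
    (isOpen_strictSublevel (continuous_trainLoss e.continuous φ hφ) α) θ hθ m (by omega)
  obtain ⟨θ₂, hθ₂, hR⟩ := exists_full_row_rank e he θ₁ m hk hkN hinj
  exact ⟨θ₂, hθ₁.trans (hθ₂.mono (setOf_layerOutput_eq_subset φ hθ₁.target_mem)), hR⟩

end NeuralLoss

theorem theorem2 (L N : ℕ) (n : ℕ → ℕ) (hn : ∀ l ≤ L, 0 < n l)
    (σ : ℝ → ℝ) (hσ₁ : NeuralLoss.StrictlyMonotonicOnto σ)
    (hσ₂ : NeuralLoss.NoShiftDependence σ)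
    (X : Matrix (Fin N) (Fin (n 0)) ℝ) (hX : Function.Injective fun i : Fin N => X i)
    (φ : Matrix (Fin N) (Fin (n L)) ℝ → ℝ) (hφ : ConvexOn ℝ Set.univ φ)
    (k : ℕ) (hk₁ : 1 ≤ k) (hkL : k + 1 ≤ L) (hkN : N ≤ n k)
    (hdec : ∀ l, k + 1 ≤ l → l + 1 ≤ L → n (l + 1) < n l) :
    (∀ C : Set (NeuralLoss.Params L n),
      ¬ NeuralLoss.IsBadLocalValley (NeuralLoss.trainLoss σ X φ) (NeuralLoss.optValue φ) C) ∧
    (k + 2 ≤ L → ∀ C : Set (NeuralLoss.Params L n),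
      NeuralLoss.IsLocalValley (NeuralLoss.trainLoss σ X φ) C → ¬ Bornology.IsBounded C) := by
  obtain ⟨e, rfl⟩ := hσ₁.exists_homeomorph
  constructor
  · rintro C ⟨⟨α, θ, hθ, rfl⟩, hbad⟩
    refine hbad fun c hc => ?_
    obtain ⟨G, hG⟩ := iInf_lt_iff.1 hc
    have hGc : φ G < c := EReal.coe_lt_coe_iff.1 hG
    by_cases hθc : trainLoss e X φ θ < c
    · exact ⟨θ, mem_pathComponentIn_self hθ, hθc⟩
    -- Hence `φ G < α` too, so both ends of the output segment lie below `α`.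
    have hcα : c < α := (not_lt.1 hθc).trans_lt hθ
    obtain ⟨θ₁, hθ₁, R, hR⟩ :=
      exists_joinedIn_full_row_rank e hσ₂ hX hn φ hφ k hk₁ hkL hkN hθ
    obtain ⟨θ₂, hθ₂, hk₂, hQ⟩ := exists_full_column_rank e θ₁ k hkL R hR
      (fun l h1 h2 => (hdec l h1 h2).le) L hkL le_rfl
    have hθ₂ := hθ₁.trans (hθ₂.mono (setOf_layerOutput_eq_subset φ hθ₁.target_mem))
    have hα : φ (layerOutput e X θ₂ L le_rfl) < α := hθ₂.target_mem
    obtain ⟨p, hp, hp0, hpt⟩ := exists_lift e θ₂ k hkL R (by rw [hk₂, hR]) L hkL le_rfl hQ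
      (fun t => layerOutput e X θ₂ L le_rfl + t • (G - layerOutput e X θ₂ L le_rfl))
      (by fun_prop) (by simp)
    have h3 := joinedIn_update (U := strictSublevel (trainLoss e X φ) α) θ₂ ⟨k, hkL⟩ p hp hp0
      fun t ht => by
        change φ _ < α
        rw [hpt]
        have h := hφ.2 (mem_univ (layerOutput e X θ₂ L le_rfl)) (mem_univ G)
          (sub_nonneg.2 ht.2) ht.1 (sub_add_cancel 1 t)
        rw [show layerOutput e X θ₂ L le_rfl + t • (G - layerOutput e X θ₂ L le_rfl) =
          (1 - t) • layerOutput e X θ₂ L le_rfl + t • G by module]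
        refine h.trans_lt ?_
        exact (convex_Iio α) hα (hGc.trans hcα) (sub_nonneg.2 ht.2) ht.1 (sub_add_cancel 1 t)
    refine ⟨_, hθ₂.trans h3, ?_⟩
    change φ _ < c
    rw [hpt, one_smul, add_sub_cancel]
    exact hGc
  · rintro hk2 C ⟨α, θ, hθ, rfl⟩ hb
    have hl : k + 1 < L := hk2
    obtain ⟨θ₁, hθ₁, R, hR⟩ :=
      exists_joinedIn_full_row_rank e hσ₂ hX hn φ hφ k hk₁ hkL hkN hθ
    obtain ⟨P, V, hPW, hPV, hV⟩ := exists_projection_and_nonzero (hn (k + 1 + 1) hk2)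
      (hdec (k + 1) le_rfl hk2) (weight θ₁ (k + 1) hl)
    obtain ⟨i, c, hic⟩ : ∃ i c, V i c ≠ 0 := by
      by_contra! h
      exact hV (Matrix.ext h)
    have hcont : ∃ B, ∀ η ∈ pathComponentIn (strictSublevel (trainLoss e X φ) α) θ,
        ‖weight η (k + 1) hl i c‖ ≤ B := by
      have h1 := (Bornology.isBounded_image_fst_and_snd.2
        (Bornology.forall_isBounded_image_eval_iff.2 hb ⟨k + 1, hl⟩)).1
      have h2 := Bornology.forall_isBounded_image_eval_iff.2
        (Bornology.forall_isBounded_image_eval_iff.2 h1 i) c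
      obtain ⟨B, hB⟩ := h2.exists_norm_le
      exact ⟨B, fun η hη => hB _ ⟨_, ⟨_, ⟨_, ⟨η, hη, rfl⟩, rfl⟩, rfl⟩, rfl⟩⟩
    obtain ⟨B, hB⟩ := hcont
    have key : ∀ s : ℝ, ‖weight θ₁ (k + 1) hl i c + s * V i c‖ ≤ B := fun s => by
      -- No weights lie between the layers `k` and `k + 1` here, so the rank condition is vacuous.
      obtain ⟨θ₂, hθ₂, hW, -⟩ := exists_shift_weight e θ₁ k hkL R hR (k + 1) le_rfl hl
        (fun j _ h1 h2 => by omega) P (s • V) hPW (by rw [Matrix.mul_smul, hPV, smul_zero])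
      have := hB θ₂ (hθ₁.trans (hθ₂.mono (setOf_layerOutput_eq_subset φ hθ₁.target_mem)))
      rwa [hW] at this
    -- This `s` makes the entry equal to `B + 1`.
    have h := key ((B + 1 - weight θ₁ (k + 1) hl i c) / V i c)
    rw [div_mul_cancel₀ _ hic, add_sub_cancel] at h
    linarith [(le_abs_self (B + 1)).trans h]
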